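/- Let $\omega+1=\omega\cup\{\omega\}$ carry the interval topology, let $X_0=(\omega+1)\times(\omega+1)\setminus\{(\omega,\omega)\}$ carry the subspace topology of the product, and put $g_1=\{(i,j)\in X_0: i\le j\}$, $g_2=X_0\setminus g_1$. Let $X=X_0\cup\{k_1,k_2\}$ with two new points $k_1\ne k_2$, topologized by the sets $U$ and the sets $U\cup\{k_s\}$ with $g_s\setminus U$ compact ($s=1,2$), where $U$ ranges over the clopen subsets of $X_0$. Let $E_1$ be the equivalence relation on $X$ whose classes are the rows (points of $X_0$ with the same second coordinate) and $E_2$ the one whose classes are the columns (same first coordinate), where $k_1,k_2$ belong to both the row and the column of index $\omega$. Let $\mathfrak F=(X,E_1,E_2)$. A descriptive $\mathsf{MS4}$-frame $(X,R,E)$ is a Stone space $X$ with a quasi-order $R$ and an equivalence relation $E$, such that the sets $R(x)$, $E(x)$ are closed for all $x\in X$, the sets $R^{-1}(U)$, $E(U)$ are clopen for all clopen $U$, and $x\,E\,y\,R\,y'$ implies $x\,R\,x'\,E\,y'$ for some $x'$; it is a descriptive $\mathsf{S5}^2$-frame if $R$ is an equivalence relation too. Its dual algebra is the Boolean algebra of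 clopen subsets of $X$ with the operators $\lozenge U=R^{-1}(U)$ and $\exists U=E(U)$; the frame is called finitely generated (one-generated) if its dual algebra is so as a Boolean algebra with the operators $\lozenge,\exists$. A point $x$ has depth $1$ if $x\,R\,y$ implies $y\,R\,x$. The Erdős–Tarski algebra is the subalgebra, generated by $\{(i,j): i\le j\}$, of the powerset algebra of $\omega\times\omega$ in which $\lozenge$ and $\exists$ saturate a set under the relations "same second coordinate" and "same first coordinate", respectively. **Theorem.** The sets listed above form a basis of a topology on $X$, and $X_0$ (with its own topology) is a dense open subspace of $X$. $\mathfrak F$ (with $R=E_1$, $E=E_2$) is a descriptive $\mathsf{S5}^2$-frame, so its dual algebra $\mathfrak F^*$ satisfies $\lozenge\square a\le\square a$, where $\square=-\lozenge-$. The set $g=g_1\cup\{k_1\}$ is clopen in $X$ and $\mathfrak F^*$ is generated by the single element $g$, so $\mathfrak F$ is one-generated. $\mathfrak F^*$ is isomorphic to the Erdős–Tarski algebra. Hence $\mathfrak F$ is a finitely generated descriptive $\mathsf{MS4}$-frame all of whose points have depth $1$; there are infinitely many of them, and infinitely many of them are limit points of $X$. -/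

import Mathlib

/-! ### MS4-algebras -/

/-- An MS4-algebra structure on a Boolean algebra `B`: `dia` is an S4-possibility operator, `ex` is
an S5-possibility operator, and `ex (dia a) ≤ dia (ex a)`. -/
structure MS4Algebra (B : Type*) [BooleanAlgebra B] where
  dia : B → B
  ex : B → B
  dia_bot : dia ⊥ = ⊥
  dia_sup : ∀ a b, dia (a ⊔ b) = dia a ⊔ dia b
  le_dia : ∀ a, a ≤ dia a
  dia_dia_le : ∀ a, dia (dia a) ≤ dia a
  ex_bot : ex ⊥ = ⊥
  ex_sup : ∀ a b, ex (a ⊔ b) = ex a ⊔ ex b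
  le_ex : ∀ a, a ≤ ex a
  ex_ex_le : ∀ a, ex (ex a) ≤ ex a
  /-- `∃ ∀ a ≤ ∀ a`, where `∀ = - ∃ -`. -/
  ex_all_le : ∀ a, ex (ex aᶜ)ᶜ ≤ (ex aᶜ)ᶜ
  ex_dia_le : ∀ a, ex (dia a) ≤ dia (ex a)

namespace MS4Algebra

/-- S5²-algebras: MS4-algebras with `◇ □ a ≤ □ a`, where `□ = - ◇ -`. -/
def IsS5Sq {B : Type*} [BooleanAlgebra B] (A : MS4Algebra B) : Prop :=
  ∀ a, A.dia (A.dia aᶜ)ᶜ ≤ (A.dia aᶜ)ᶜ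

/-- A Boolean subalgebra that is closed under both operators, i.e. (the universe of) an
MS4-subalgebra. -/
def IsSubalgebra {B : Type*} [BooleanAlgebra B] (A : MS4Algebra B) (L : BooleanSubalgebra B) :
    Prop :=
  (∀ a ∈ L, A.dia a ∈ L) ∧ ∀ a ∈ L, A.ex a ∈ L

/-- The MS4-subalgebra generated by a set: the least one that contains it. -/
def generated {B : Type*} [BooleanAlgebra B] (A : MS4Algebra B) (s : Set B) :
    BooleanSubalgebra B :=
  sInf {L | s ⊆ L ∧ A.IsSubalgebra L}

theorem generated_isSubalgebra {B : Type*} [BooleanAlgebra B] (A : MS4Algebra B) (s : Set B) :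
    A.IsSubalgebra (A.generated s) := by
  constructor
  · intro a ha
    refine BooleanSubalgebra.mem_sInf.2 fun L hL => hL.2.1 a ?_
    exact BooleanSubalgebra.mem_sInf.1 ha L hL
  · intro a ha
    refine BooleanSubalgebra.mem_sInf.2 fun L hL => hL.2.2 a ?_
    exact BooleanSubalgebra.mem_sInf.1 ha L hL

/-- `A` is generated by the set `s`. -/
def IsGeneratedBy {B : Type*} [BooleanAlgebra B] (A : MS4Algebra B) (s : Set B) : Prop :=
  A.generated s = ⊤

/-- `A` is generated by one element. -/
def IsOneGenerated {B : Type*} [BooleanAlgebra B] (A : MS4Algebra B) : Prop :=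
  ∃ a : B, A.IsGeneratedBy {a}

/-- `A` is finitely generated. -/
def IsFinitelyGenerated {B : Type*} [BooleanAlgebra B] (A : MS4Algebra B) : Prop :=
  ∃ s : Set B, s.Finite ∧ A.IsGeneratedBy s

/-- A subalgebra is an MS4-algebra under the restricted operators. -/
def restrict {B : Type*} [BooleanAlgebra B] (A : MS4Algebra B) (L : BooleanSubalgebra B)
    (hL : A.IsSubalgebra L) : MS4Algebra L where
  dia a := ⟨A.dia a, hL.1 a a.2⟩
  ex a := ⟨A.ex a, hL.2 a a.2⟩
  dia_bot := Subtype.ext A.dia_bot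
  dia_sup a b := Subtype.ext (A.dia_sup a b)
  le_dia a := A.le_dia a
  dia_dia_le a := A.dia_dia_le a
  ex_bot := Subtype.ext A.ex_bot
  ex_sup a b := Subtype.ext (A.ex_sup a b)
  le_ex a := A.le_ex a
  ex_ex_le a := A.ex_ex_le a
  ex_all_le a := A.ex_all_le a
  ex_dia_le a := A.ex_dia_le a

/-- Isomorphism of MS4-algebras: an isomorphism of the Boolean algebras (equivalently, of their
orders) that commutes with both operators. -/
def IsIsomorphic {B C : Type*} [BooleanAlgebra B] [BooleanAlgebra C] (A : MS4Algebra B)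
    (A' : MS4Algebra C) : Prop :=
  ∃ e : B ≃o C, (∀ a, e (A.dia a) = A'.dia (e a)) ∧ ∀ a, e (A.ex a) = A'.ex (e a)

end MS4Algebra

/-! ### Descriptive frames and their dual algebras -/

/-- A Stone space: compact, Hausdorff, with a basis of clopen sets. -/
structure IsStoneSpace (X : Type*) [TopologicalSpace X] : Prop where
  compact : CompactSpace X
  hausdorff : T2Space X
  zeroDim : TopologicalSpace.IsTopologicalBasis {U : Set X | IsClopen U}

/-- Continuous relations: `R(x)` is closed for each point `x`, and `R⁻¹(U)` is clopen for each
clopen set `U`. -/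
structure IsContinuousRel {X : Type*} [TopologicalSpace X] (R : X → X → Prop) : Prop where
  pointClosed : ∀ x, IsClosed {y | R x y}
  clopen_preimage : ∀ U : Set X, IsClopen U → IsClopen {y | ∃ x ∈ U, R y x}

/-- `(X, R, E)` is a descriptive MS4-frame. -/
structure IsDescriptiveMS4Frame (X : Type*) [TopologicalSpace X] (R E : X → X → Prop) : Prop where
  stone : IsStoneSpace X
  refl : ∀ x, R x x
  trans : ∀ x y z, R x y → R y z → R x z
  equiv : Equivalence E
  cont_R : IsContinuousRel R
  cont_E : IsContinuousRel E
  comm : ∀ x y y', E x y → R y y' → ∃ x', R x x' ∧ E x' y'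

/-- `(X, R, E)` is a descriptive S5²-frame: a descriptive MS4-frame in which `R` is an equivalence
relation as well. -/
structure IsDescriptiveS5SqFrame (X : Type*) [TopologicalSpace X] (R E : X → X → Prop) : Prop
    extends IsDescriptiveMS4Frame X R E where
  symm : ∀ x y, R x y → R y x

/-- The dual algebra of a descriptive MS4-frame: clopen sets, with `◇ U = R⁻¹(U)` and
`∃ U = E(U)`. -/
def dualAlgebra {X : Type*} [TopologicalSpace X] {R E : X → X → Prop}
    (h : IsDescriptiveMS4Frame X R E) : MS4Algebra (TopologicalSpace.Clopens X) where
  dia U := ⟨{y | ∃ x ∈ U, R y x}, h.cont_R.clopen_preimage U U.isClopen⟩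
  ex U := ⟨{y | ∃ x ∈ U, E x y}, by
    have h1 := h.cont_E.clopen_preimage U U.isClopen
    have h2 : {y | ∃ x ∈ U, E x y} = {y | ∃ x ∈ (U : Set X), E y x} := by
      ext y
      exact ⟨fun ⟨x, hx, hxy⟩ => ⟨x, hx, h.equiv.symm hxy⟩,
        fun ⟨x, hx, hxy⟩ => ⟨x, hx, h.equiv.symm hxy⟩⟩
    rw [h2]
    exact h1⟩
  dia_bot := by
    ext y
    exact ⟨fun ⟨_, hx, _⟩ => hx.elim, fun hy => hy.elim⟩
  dia_sup U V := by
    ext y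
    constructor
    · rintro ⟨x, hx | hx, hxy⟩
      · exact Or.inl ⟨x, hx, hxy⟩
      · exact Or.inr ⟨x, hx, hxy⟩
    · rintro (⟨x, hx, hxy⟩ | ⟨x, hx, hxy⟩)
      · exact ⟨x, Or.inl hx, hxy⟩
      · exact ⟨x, Or.inr hx, hxy⟩
  le_dia U := fun y hy => ⟨y, hy, h.refl y⟩
  dia_dia_le U := fun y ⟨_, ⟨z, hz, hxz⟩, hyx⟩ => ⟨z, hz, h.trans _ _ _ hyx hxz⟩
  ex_bot := by
    ext y
    exact ⟨fun ⟨_, hx, _⟩ => hx.elim, fun hy => hy.elim⟩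
  ex_sup U V := by
    ext y
    constructor
    · rintro ⟨x, hx | hx, hxy⟩
      · exact Or.inl ⟨x, hx, hxy⟩
      · exact Or.inr ⟨x, hx, hxy⟩
    · rintro (⟨x, hx, hxy⟩ | ⟨x, hx, hxy⟩)
      · exact ⟨x, Or.inl hx, hxy⟩
      · exact ⟨x, Or.inr hx, hxy⟩
  le_ex U := fun y hy => ⟨y, hy, h.equiv.refl y⟩
  ex_ex_le U := fun y ⟨_, ⟨z, hz, hzx⟩, hxy⟩ => ⟨z, hz, h.equiv.trans hzx hxy⟩
  ex_all_le U := fun _ ⟨_, hx, hxy⟩ ⟨z, hz, hzy⟩ =>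
    hx ⟨z, hz, h.equiv.trans hzy (h.equiv.symm hxy)⟩
  ex_dia_le U := fun y ⟨x, ⟨z, hz, hxz⟩, hxy⟩ => by
    obtain ⟨w, hyw, hwz⟩ := h.comm y x z (h.equiv.symm hxy) hxz
    exact ⟨w, ⟨z, hz, h.equiv.symm hwz⟩, hyw⟩

/-- `max A = {x ∈ A | x R y and y ∈ A imply y R x}`. The first layer `D₁` (the set of points of
depth 1) of a frame `(X, R, E)` is `max X`. -/
def quasiMax {X : Type*} (R : X → X → Prop) (A : Set X) : Set X :=
  {x | x ∈ A ∧ ∀ y ∈ A, R x y → R y x}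

/-! ### The Erdős–Tarski algebra -/

/-- The powerset of `ω × ω`, where `◇` saturates a set under the relation "same second coordinate"
(same row) and `∃` saturates it under "same first coordinate" (same column). -/
def squareAlgebra : MS4Algebra (Set (ℕ × ℕ)) where
  dia S := {p | ∃ q ∈ S, q.2 = p.2}
  ex S := {p | ∃ q ∈ S, q.1 = p.1}
  dia_bot := by
    ext y
    exact ⟨fun ⟨_, hx, _⟩ => hx.elim, fun hy => hy.elim⟩
  dia_sup U V := by
    ext y
    constructor
    · rintro ⟨x, hx | hx, hxy⟩
      · exact Or.inl ⟨x, hx, hxy⟩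
      · exact Or.inr ⟨x, hx, hxy⟩
    · rintro (⟨x, hx, hxy⟩ | ⟨x, hx, hxy⟩)
      · exact ⟨x, Or.inl hx, hxy⟩
      · exact ⟨x, Or.inr hx, hxy⟩
  le_dia U := fun y hy => ⟨y, hy, rfl⟩
  dia_dia_le U := fun y ⟨_, ⟨z, hz, hzx⟩, hxy⟩ => ⟨z, hz, hzx.trans hxy⟩
  ex_bot := by
    ext y
    exact ⟨fun ⟨_, hx, _⟩ => hx.elim, fun hy => hy.elim⟩
  ex_sup U V := by
    ext y
    constructor
    · rintro ⟨x, hx | hx, hxy⟩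
      · exact Or.inl ⟨x, hx, hxy⟩
      · exact Or.inr ⟨x, hx, hxy⟩
    · rintro (⟨x, hx, hxy⟩ | ⟨x, hx, hxy⟩)
      · exact ⟨x, Or.inl hx, hxy⟩
      · exact ⟨x, Or.inr hx, hxy⟩
  le_ex U := fun y hy => ⟨y, hy, rfl⟩
  ex_ex_le U := fun y ⟨_, ⟨z, hz, hzx⟩, hxy⟩ => ⟨z, hz, hzx.trans hxy⟩
  ex_all_le U := fun _ ⟨_, hx, hxy⟩ ⟨z, hz, hzy⟩ => hx ⟨z, hz, hzy.trans hxy.symm⟩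
  ex_dia_le U := fun y ⟨x, ⟨z, hz, hzx⟩, hxy⟩ => ⟨(z.1, y.2), ⟨z, hz, rfl⟩, rfl⟩

/-- The set `{(i, j) | i ≤ j}` in `ω × ω`. -/
def upperTriangle : Set (ℕ × ℕ) := {p | p.1 ≤ p.2}

/-- The universe of the Erdős–Tarski algebra. -/
abbrev ErdosTarski : Type := squareAlgebra.generated {upperTriangle}

/-- The Erdős–Tarski algebra: the subalgebra of the powerset of `ω × ω` generated by the element
`{(i, j) | i ≤ j}`. -/
def erdosTarskiAlgebra : MS4Algebra ErdosTarski :=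
  squareAlgebra.restrict _ (squareAlgebra.generated_isSubalgebra {upperTriangle})

/-! ### The frame -/

/-- `X₀ = (ω + 1) × (ω + 1) - {(ω, ω)}`, with the subspace topology of the product topology, where
`ω + 1 = ℕ∞` has the order topology. -/
abbrev PuncturedSquare : Type := {p : ℕ∞ × ℕ∞ // p ≠ (⊤, ⊤)}

/-- `g₁ = {(i, j) | i ≤ j} ∩ X₀`. -/
def g₁ : Set PuncturedSquare := {p | p.1.1 ≤ p.1.2}

/-- `g₂ = X₀ - g₁`. -/
def g₂ : Set PuncturedSquare := g₁ᶜ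

/-- The point set `X = X₀ ∪ {k₁, k₂}`. -/
inductive FrameSpace : Type
  | pt (p : PuncturedSquare) : FrameSpace
  | k₁ : FrameSpace
  | k₂ : FrameSpace

namespace FrameSpace

/-- The clopen subsets `U` of `X₀`, together with the sets `U ∪ {kᵢ}` where `U` is clopen in `X₀`
and `gᵢ - U` is compact, for `i = 1, 2`. -/
def basis : Set (Set FrameSpace) :=
  {V | ∃ U : Set PuncturedSquare, IsClopen U ∧ V = pt '' U} ∪
  {V | ∃ U : Set PuncturedSquare, IsClopen U ∧ IsCompact (g₁ \ U) ∧ V = pt '' U ∪ {k₁}} ∪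
  {V | ∃ U : Set PuncturedSquare, IsClopen U ∧ IsCompact (g₂ \ U) ∧ V = pt '' U ∪ {k₂}}

instance : TopologicalSpace FrameSpace := TopologicalSpace.generateFrom basis

/-- The index of the column of a point; `k₁` and `k₂` lie in column `ω`. -/
def column : FrameSpace → ℕ∞
  | pt p => p.1.1
  | k₁ => ⊤
  | k₂ => ⊤

/-- The index of the row of a point; `k₁` and `k₂` lie in row `ω`. -/
def row : FrameSpace → ℕ∞
  | pt p => p.1.2
  | k₁ => ⊤
  | k₂ => ⊤

/-- The classes of `E₁` are the rows. -/
def E₁ (x y : FrameSpace) : Prop := row x = row y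

/-- The classes of `E₂` are the columns. -/
def E₂ (x y : FrameSpace) : Prop := column x = column y

/-- `g = g₁ ∪ {k₁}`. -/
def g : Set FrameSpace := pt '' g₁ ∪ {k₁}

end FrameSpace

open Set Filter Topology

/-! `X` is compact because `k₁` compactifies `g₁` and `k₂` compactifies `g₂`: outside neighbourhoods
of both points only a compact part of `X₀` remains. The maps `column` and `row` into `ω + 1` are
continuous, and they are open because every point with a coordinate `ω` is a limit of points `fin i
j` in which that coordinate runs through almost all of `ω`. Since `E₁` and `E₂` are the kernels of
`row` and `column`, `isContinuousRel_ker` applies. The only two points with the same column and row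
are `k₁` and `k₂`, and `g` tells them apart (`ext_column_row`).

Generation is a staircase along the diagonal: `rowGE_eq` gets the rows from `n` on out of the
columns from `n` on, and `columnGE_succ_eq` gets from these the columns from `n + 1` on. Together
with `g` these sets separate points, and by compactness a separating algebra of clopen sets contains
all of them (`BooleanSubalgebra.eq_top_of_separating`).

The points `fin i j` are dense, so restricting clopen sets to `ω × ω` is an embedding
(`le_of_trace_le`). It preserves the operators because rows and columns of finite index are open. It
sends `g` to the upper triangle, so its image is the Erdős–Tarski algebra. -/

theorem ENat.isClopen_singleton_natCast (n : ℕ) : IsClopen {(n : ℕ∞)} :=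
  ⟨isClosed_singleton, ENat.isOpen_singleton (ENat.natCast_ne_top n)⟩

/-- A map to `ℕ∞` is continuous as soon as its fibres over the finite points are clopen. -/
theorem ENat.continuous_of_isClopen_fiber {Y : Type*} [TopologicalSpace Y] {f : Y → ℕ∞}
    (h : ∀ n : ℕ, IsClopen (f ⁻¹' {(n : ℕ∞)})) : Continuous f := by
  refine continuous_iff_continuousAt.2 fun y => ?_
  by_cases hy : f y = ⊤
  · rw [ContinuousAt, hy, ENat.tendsto_nhds_top_iff_natCast_lt]
    intro n
    -- Exceeding `n` means avoiding the finitely many values `0, …, n`, each of which has a clopen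
    -- fibre.
    have h1 : ∀ᶠ a in 𝓝 y, ∀ m ∈ Finset.range (n + 1), f a ≠ m := by
      refine (Finset.eventually_all _).2 fun m _ => ?_
      refine (h m).compl.isOpen.mem_nhds ?_
      simp [hy]
    filter_upwards [h1] with a ha
    by_contra! hlt
    obtain ⟨m, hm⟩ := ENat.ne_top_iff_exists.1 (ne_top_of_le_ne_top (ENat.natCast_ne_top n) hlt)
    rw [← hm] at hlt
    exact ha m (Finset.mem_range.2 (Nat.lt_succ_of_le (by exact_mod_cast hlt))) hm.symm
  · obtain ⟨m, hm⟩ := ENat.ne_top_iff_exists.1 hy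
    rw [ContinuousAt, ENat.nhds_eq_pure hy, tendsto_pure]
    have := (h m).isOpen.mem_nhds (show y ∈ f ⁻¹' {(m : ℕ∞)} from hm.symm)
    filter_upwards [this] with a ha
    rw [← hm]
    exact ha

/-- A set in `ℕ∞` is open if, in case it contains `⊤`, it contains almost all natural numbers. -/
theorem ENat.isOpen_of_eventually {S : Set ℕ∞}
    (h : (⊤ : ℕ∞) ∈ S → ∀ᶠ n : ℕ in atTop, (n : ℕ∞) ∈ S) : IsOpen S := by
  rw [isOpen_iff_mem_nhds]
  intro x hx
  by_cases hxt : x = ⊤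
  · subst hxt
    obtain ⟨N, hN⟩ := eventually_atTop.1 (h hx)
    filter_upwards [Ioi_mem_nhds (show (N : ℕ∞) < ⊤ from ENat.natCast_lt_top N)] with y hy
    by_cases hyt : y = ⊤
    · exact hyt ▸ hx
    · obtain ⟨m, rfl⟩ := ENat.ne_top_iff_exists.1 hyt
      exact hN m (by exact_mod_cast (mem_Ioi.1 hy).le)
  · exact (ENat.mem_nhds_iff hxt).2 hx

theorem ENat.isClopen_Ici_natCast (n : ℕ) : IsClopen (Ici (n : ℕ∞)) := by
  refine ⟨isClosed_Ici, ENat.isOpen_of_eventually fun _ => ?_⟩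
  filter_upwards [eventually_ge_atTop n] with m hm
  exact mem_Ici.2 (by exact_mod_cast hm)

/-! ### The punctured square -/

instance PuncturedSquare.locallyCompactSpace : LocallyCompactSpace PuncturedSquare :=
  (isOpen_ne (x := ((⊤, ⊤) : ℕ∞ × ℕ∞))).locallyCompactSpace

/-- Distinct points differ in some coordinate, where one of the two values is finite and so has a
clopen fibre. Local compactness then upgrades separation to a clopen basis. -/
theorem PuncturedSquare.isTopologicalBasis_isClopen :
    TopologicalSpace.IsTopologicalBasis {U : Set PuncturedSquare | IsClopen U} := by
  have : TotallySeparatedSpace PuncturedSquare := by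
    rw [totallySeparatedSpace_iff_exists_isClopen]
    have key : ∀ f : PuncturedSquare → ℕ∞, Continuous f → ∀ x y, f x ≠ f y →
        ∃ U : Set PuncturedSquare, IsClopen U ∧ x ∈ U ∧ y ∈ Uᶜ := by
      intro f hf x y hxy
      by_cases hx : f x = ⊤
      · obtain ⟨m, hm⟩ := ENat.ne_top_iff_exists.1 (hx ▸ hxy).symm
        refine ⟨(f ⁻¹' {(m : ℕ∞)})ᶜ, ((ENat.isClopen_singleton_natCast m).preimage hf).compl, ?_, ?_⟩
        · simp [hx]
        · simp [hm]
      · obtain ⟨m, hm⟩ := ENat.ne_top_iff_exists.1 hx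
        refine ⟨f ⁻¹' {(m : ℕ∞)}, (ENat.isClopen_singleton_natCast m).preimage hf, hm.symm, ?_⟩
        intro hy
        exact hxy (hm.symm.trans (mem_singleton_iff.1 hy).symm)
    intro x y hxy
    by_cases h1 : x.1.1 = y.1.1
    · exact key (fun p => p.1.2) (by fun_prop) x y fun h2 => hxy (Subtype.ext (Prod.ext h1 h2))
    · exact key (fun p => p.1.1) (by fun_prop) x y h1
  exact loc_compact_Haus_tot_disc_of_zero_dim

theorem isClopen_g₁ : IsClopen g₁ := by
  constructor
  · exact isClosed_le (by fun_prop) (by fun_prop)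
  · rw [← isClosed_compl_iff]
    -- For `b` finite, `b < a` is the closed condition `b + 1 ≤ a`. For `b = ⊤` both fail, but only
    -- because the corner has been removed.
    have : g₁ᶜ = {p : PuncturedSquare | p.1.2 + 1 ≤ p.1.1} := by
      ext ⟨⟨a, b⟩, hp⟩
      simp only [g₁, mem_compl_iff, mem_ofPred_eq, not_le]
      by_cases hb : b = ⊤
      · subst hb
        simp only [ne_eq, Prod.mk.injEq, and_true] at hp
        simp [hp]
      · exact (ENat.add_one_le_iff hb).symm
    rw [this]
    exact isClosed_le (by fun_prop) (by fun_prop)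

theorem isClopen_g₂ : IsClopen g₂ := isClopen_g₁.compl

theorem PuncturedSquare.isCompact_column (n : ℕ) :
    IsCompact {p : PuncturedSquare | p.1.1 = n} := by
  rw [Subtype.isCompact_iff]
  have : Subtype.val '' {p : PuncturedSquare | p.1.1 = n} = {(n : ℕ∞)} ×ˢ univ := by
    ext ⟨a, b⟩
    constructor
    · rintro ⟨p, hp, h⟩
      simp only [mem_ofPred_eq] at hp
      simp [← hp, h]
    · rintro ⟨h, -⟩
      obtain rfl : a = n := h
      exact ⟨⟨(n, b), by simp⟩, rfl, rfl⟩
  rw [this]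
  exact isCompact_singleton.prod isCompact_univ

theorem PuncturedSquare.isCompact_row (n : ℕ) :
    IsCompact {p : PuncturedSquare | p.1.2 = n} := by
  rw [Subtype.isCompact_iff]
  have : Subtype.val '' {p : PuncturedSquare | p.1.2 = n} = univ ×ˢ {(n : ℕ∞)} := by
    ext ⟨a, b⟩
    constructor
    · rintro ⟨p, hp, h⟩
      simp only [mem_ofPred_eq] at hp
      simp [← hp, h]
    · rintro ⟨-, h⟩
      obtain rfl : b = n := h
      exact ⟨⟨(a, n), by simp⟩, rfl, rfl⟩
  rw [this]
  exact isCompact_univ.prod isCompact_singleton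

/-! ### The topology of the frame -/

namespace FrameSpace

theorem pt_injective : Function.Injective pt := fun _ _ h => by simpa using h

theorem isOpen_image_pt_of_isClopen {U : Set PuncturedSquare} (hU : IsClopen U) :
    IsOpen (pt '' U) :=
  TopologicalSpace.isOpen_generateFrom_of_mem (Or.inl (Or.inl ⟨U, hU, rfl⟩))

theorem isOpen_image_union_k₁ {U : Set PuncturedSquare} (hU : IsClopen U)
    (h : IsCompact (g₁ \ U)) : IsOpen (pt '' U ∪ {k₁}) :=
  TopologicalSpace.isOpen_generateFrom_of_mem (Or.inl (Or.inr ⟨U, hU, h, rfl⟩))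

theorem isOpen_image_union_k₂ {U : Set PuncturedSquare} (hU : IsClopen U)
    (h : IsCompact (g₂ \ U)) : IsOpen (pt '' U ∪ {k₂}) :=
  TopologicalSpace.isOpen_generateFrom_of_mem (Or.inr ⟨U, hU, h, rfl⟩)

theorem isTopologicalBasis_basis : TopologicalSpace.IsTopologicalBasis basis := by
  refine ⟨?_, ?_, rfl⟩
  · intro V hV W hW x hx
    refine ⟨V ∩ W, ?_, hx, subset_rfl⟩
    rcases hV with (⟨U, hU, rfl⟩ | ⟨U, hU, hc, rfl⟩) | ⟨U, hU, hc, rfl⟩ <;>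
    rcases hW with (⟨U', hU', rfl⟩ | ⟨U', hU', hc', rfl⟩) | ⟨U', hU', hc', rfl⟩
    case inl.inr.inl.inr =>
      refine Or.inl (Or.inr ⟨U ∩ U', hU.inter hU', ?_, ?_⟩)
      · rw [sdiff_inter]
        exact hc.union hc'
      · rw [image_inter pt_injective, inter_union_distrib_right]
    -- Except for two neighbourhoods of `k₂`, the remaining pairs meet inside `X₀`, so no
    -- compactness condition is left to check.
    all_goals
      first
        | refine Or.inl (Or.inl ⟨U ∩ U', hU.inter hU', ?_⟩)
          ext (p | _ | _) <;> simp
          done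
        | refine Or.inr ⟨U ∩ U', hU.inter hU', ?_, ?_⟩
          · rw [sdiff_inter]
            exact hc.union hc'
          · rw [image_inter pt_injective, inter_union_distrib_right]
  · refine eq_univ_of_forall fun x => ?_
    rcases x with p | _ | _
    · exact ⟨pt '' univ, Or.inl (Or.inl ⟨univ, isClopen_univ, rfl⟩), p, trivial, rfl⟩
    · exact ⟨pt '' univ ∪ {k₁}, Or.inl (Or.inr ⟨univ, isClopen_univ, by simp, rfl⟩), Or.inr rfl⟩
    · exact ⟨pt '' univ ∪ {k₂}, Or.inr ⟨univ, isClopen_univ, by simp, rfl⟩, Or.inr rfl⟩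

theorem continuous_pt : Continuous pt := by
  refine continuous_generateFrom_iff.2 fun V hV => ?_
  have aux : ∀ (U : Set PuncturedSquare) (k : FrameSpace), (∀ p, pt p ≠ k) →
      pt ⁻¹' (pt '' U ∪ {k}) = U := by
    intro U k hk
    ext p
    simp [hk]
  rcases hV with (⟨U, hU, rfl⟩ | ⟨U, hU, -, rfl⟩) | ⟨U, hU, -, rfl⟩
  · rw [preimage_image_eq _ pt_injective]
    exact hU.isOpen
  · rw [aux _ _ fun p => by simp]
    exact hU.isOpen
  · rw [aux _ _ fun p => by simp]
    exact hU.isOpen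

theorem isOpenEmbedding_pt : IsOpenEmbedding pt := by
  refine .of_continuous_injective_isOpenMap continuous_pt pt_injective fun U hU => ?_
  rw [PuncturedSquare.isTopologicalBasis_isClopen.open_eq_sUnion' hU, image_sUnion]
  refine isOpen_sUnion ?_
  rintro _ ⟨V, ⟨hV, -⟩, rfl⟩
  exact isOpen_image_pt_of_isClopen hV

/-- Passing from a basic neighbourhood to a larger open set shrinks the difference to a closed
subset of a compact set. -/
theorem isCompact_g₁_diff_preimage {W : Set FrameSpace} (hW : IsOpen W) (hk : k₁ ∈ W) :
    IsCompact (g₁ \ pt ⁻¹' W) := by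
  obtain ⟨V, hV, hkV, hVW⟩ := isTopologicalBasis_basis.exists_subset_of_mem_open hk hW
  have hcl : IsClosed (g₁ \ pt ⁻¹' W) := isClopen_g₁.isClosed.sdiff (hW.preimage continuous_pt)
  rcases hV with (⟨U, hU, rfl⟩ | ⟨U, hU, hc, rfl⟩) | ⟨U, hU, hc, rfl⟩
  · simp at hkV
  · exact hc.of_isClosed_subset hcl fun p hp => ⟨hp.1, fun h => hp.2 (hVW (Or.inl ⟨p, h, rfl⟩))⟩
  · simp at hkV

theorem isCompact_g₂_diff_preimage {W : Set FrameSpace} (hW : IsOpen W) (hk : k₂ ∈ W) :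
    IsCompact (g₂ \ pt ⁻¹' W) := by
  obtain ⟨V, hV, hkV, hVW⟩ := isTopologicalBasis_basis.exists_subset_of_mem_open hk hW
  have hcl : IsClosed (g₂ \ pt ⁻¹' W) := isClopen_g₂.isClosed.sdiff (hW.preimage continuous_pt)
  rcases hV with (⟨U, hU, rfl⟩ | ⟨U, hU, hc, rfl⟩) | ⟨U, hU, hc, rfl⟩
  · simp at hkV
  · simp at hkV
  · exact hc.of_isClosed_subset hcl fun p hp => ⟨hp.1, fun h => hp.2 (hVW (Or.inl ⟨p, h, rfl⟩))⟩

/-- An ultrafilter without a limit omits a neighbourhood of each of `k₁`, `k₂`, so it contains a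
compact subset of `X₀` and converges after all. -/
instance : CompactSpace FrameSpace := by
  refine ⟨isCompact_iff_ultrafilter_le_nhds.2 fun F _ => ?_⟩
  by_contra! hF
  have hk : ∀ k, ∃ W, IsOpen W ∧ k ∈ W ∧ W ∉ F := by
    intro k
    have := hF k trivial
    rw [le_nhds_iff] at this
    push Not at this
    obtain ⟨W, h1, h2, h3⟩ := this
    exact ⟨W, h2, h1, h3⟩
  obtain ⟨W₁, hW₁, hk₁, hF₁⟩ := hk k₁
  obtain ⟨W₂, hW₂, hk₂, hF₂⟩ := hk k₂
  have hc := ((isCompact_g₁_diff_preimage hW₁ hk₁).union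
    (isCompact_g₂_diff_preimage hW₂ hk₂)).image continuous_pt
  rw [← Ultrafilter.compl_mem_iff_notMem] at hF₁ hF₂
  obtain ⟨x, -, hx⟩ := isCompact_iff_ultrafilter_le_nhds.1 hc F (le_principal_iff.2 (by
    filter_upwards [hF₁, hF₂] with x h1 h2
    rcases x with p | _ | _
    · by_cases hp : p ∈ g₁
      · exact ⟨p, Or.inl ⟨hp, h1⟩, rfl⟩
      · exact ⟨p, Or.inr ⟨hp, h2⟩, rfl⟩
    · exact (h1 hk₁).elim
    · exact (h2 hk₂).elim))
  exact hF x trivial hx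

theorem isClopen_image_pt_of_isCompact {U : Set PuncturedSquare} (hU : IsClopen U)
    (hc : IsCompact U) : IsClopen (pt '' U) := by
  refine ⟨isOpen_compl_iff.1 ?_, isOpen_image_pt_of_isClopen hU⟩
  have : (pt '' U)ᶜ = (pt '' Uᶜ ∪ {k₁}) ∪ (pt '' Uᶜ ∪ {k₂}) := by
    ext (p | _ | _) <;> simp [pt_injective.eq_iff]
  rw [this]
  refine (isOpen_image_union_k₁ hU.compl ?_).union (isOpen_image_union_k₂ hU.compl ?_)
  · rw [sdiff_compl]
    exact hc.inter_left isClopen_g₁.isClosed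
  · rw [sdiff_compl]
    exact hc.inter_left isClopen_g₂.isClosed

theorem continuous_column : Continuous column := by
  refine ENat.continuous_of_isClopen_fiber fun n => ?_
  have : column ⁻¹' {(n : ℕ∞)} = pt '' {p : PuncturedSquare | p.1.1 = n} := by
    ext (p | _ | _) <;> simp [column]
  rw [this]
  exact isClopen_image_pt_of_isCompact
    ((ENat.isClopen_singleton_natCast n).preimage (f := fun p : PuncturedSquare => p.1.1)
      (by fun_prop)) (PuncturedSquare.isCompact_column n)

theorem continuous_row : Continuous row := by
  refine ENat.continuous_of_isClopen_fiber fun n => ?_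
  have : row ⁻¹' {(n : ℕ∞)} = pt '' {p : PuncturedSquare | p.1.2 = n} := by
    ext (p | _ | _) <;> simp [row]
  rw [this]
  exact isClopen_image_pt_of_isCompact
    ((ENat.isClopen_singleton_natCast n).preimage (f := fun p : PuncturedSquare => p.1.2)
      (by fun_prop)) (PuncturedSquare.isCompact_row n)

theorem isClopen_g : IsClopen g := by
  refine ⟨isOpen_compl_iff.1 ?_, isOpen_image_union_k₁ isClopen_g₁ (by simp)⟩
  have : gᶜ = pt '' g₂ ∪ {k₂} := by
    ext (p | _ | _) <;> simp [g, g₂]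
  rw [this]
  exact isOpen_image_union_k₂ isClopen_g₂ (by simp)

/-- Column, row and membership in `g` determine a point. -/
theorem ext_column_row {x y : FrameSpace} (hc : column x = column y) (hr : row x = row y)
    (hg : x ∈ g ↔ y ∈ g) : x = y := by
  rcases x with ⟨⟨a, b⟩, hp⟩ | _ | _ <;> rcases y with ⟨⟨c, d⟩, hq⟩ | _ | _ <;>
    first
      | exact absurd (Prod.ext hc hr) hp
      | exact absurd (Prod.ext hc.symm hr.symm) hq
      | simp_all [column, row, g]

/-! ### Points with finite coordinates and their limits -/

/-- The isolated point in column `i` and row `j`. -/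
def fin (i j : ℕ) : FrameSpace := pt ⟨(i, j), by simp⟩

/-- The point in column `i` and row `ω`. -/
def top (i : ℕ) : FrameSpace := pt ⟨(i, ⊤), by simp⟩

/-- The point in column `ω` and row `j`. -/
def right (j : ℕ) : FrameSpace := pt ⟨(⊤, j), by simp⟩

@[simp] theorem column_fin (i j : ℕ) : column (fin i j) = i := rfl
@[simp] theorem row_fin (i j : ℕ) : row (fin i j) = j := rfl
@[simp] theorem column_top (i : ℕ) : column (top i) = i := rfl

@[simp] theorem fin_mem_g {i j : ℕ} : fin i j ∈ g ↔ i ≤ j := by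
  simp [fin, g, g₁]

@[simp] theorem k₁_mem_g : k₁ ∈ g := Or.inr rfl

@[simp] theorem k₂_notMem_g : k₂ ∉ g := by
  simp [g]

theorem cases_point {P : FrameSpace → Prop} (fin : ∀ i j, P (fin i j)) (top : ∀ i, P (top i))
    (right : ∀ j, P (right j)) (k₁ : P k₁) (k₂ : P k₂) (x : FrameSpace) : P x := by
  rcases x with ⟨⟨a, b⟩, hp⟩ | _ | _
  · by_cases ha : a = ⊤
    · subst ha
      by_cases hb : b = ⊤
      · exact (hp (by rw [hb])).elim
      · obtain ⟨j, rfl⟩ := ENat.ne_top_iff_exists.1 hb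
        exact right j
    · obtain ⟨i, rfl⟩ := ENat.ne_top_iff_exists.1 ha
      by_cases hb : b = ⊤
      · subst hb
        exact top i
      · obtain ⟨j, rfl⟩ := ENat.ne_top_iff_exists.1 hb
        exact fin i j
  · exact k₁
  · exact k₂

theorem tendsto_fin_top (i : ℕ) : Tendsto (fun n => fin i n) atTop (𝓝 (top i)) := by
  refine (continuous_pt.tendsto _).comp (tendsto_subtype_rng.2 ?_)
  exact tendsto_const_nhds.prodMk_nhds ENat.tendsto_natCast_nhds_top

theorem tendsto_fin_right (j : ℕ) : Tendsto (fun n => fin n j) atTop (𝓝 (right j)) := by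
  refine (continuous_pt.tendsto _).comp (tendsto_subtype_rng.2 ?_)
  exact ENat.tendsto_natCast_nhds_top.prodMk_nhds tendsto_const_nhds

/-- A continuous `f` with values in `ℕ∞` omits almost all natural numbers on a compact set where
it omits `⊤`. -/
theorem eventually_notMem_image_of_isCompact {Y : Type*} [TopologicalSpace Y] {f : Y → ℕ∞}
    (hf : Continuous f) {K : Set Y} (hK : IsCompact K) (h : ∀ y ∈ K, f y ≠ ⊤) :
    ∀ᶠ n : ℕ in atTop, (n : ℕ∞) ∉ f '' K := by
  refine ENat.tendsto_natCast_nhds_top.eventually ((hK.image hf).isClosed.isOpen_compl.mem_nhds ?_)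
  rintro ⟨y, hy, hy'⟩
  exact h y hy hy'

/-- In `g₁` column `ω` would force row `ω`, the missing corner. Hence a compact subset of `g₁` meets
only finitely many columns and misses almost all of the diagonal. -/
theorem tendsto_fin_k₁ : Tendsto (fun n => fin n n) atTop (𝓝 k₁) := by
  refine tendsto_nhds.2 fun W hW hk => ?_
  have h := eventually_notMem_image_of_isCompact
    (f := fun p : PuncturedSquare => p.1.1) (by fun_prop) (isCompact_g₁_diff_preimage hW hk) (by
      rintro ⟨⟨a, b⟩, hp⟩ ⟨h1, -⟩ (rfl : a = ⊤)
      exact hp (by simpa [g₁] using h1))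
  filter_upwards [h] with n hn
  by_contra hnW
  exact hn ⟨⟨(n, n), by simp⟩, ⟨by simp [g₁], hnW⟩, rfl⟩

/-- `g₂` contains no point of row `ω`, so here it is the rows that bound a compact subset. The
points `(n + 1, n)` lie just below the diagonal. -/
theorem tendsto_fin_k₂ : Tendsto (fun n => fin (n + 1) n) atTop (𝓝 k₂) := by
  refine tendsto_nhds.2 fun W hW hk => ?_
  have h := eventually_notMem_image_of_isCompact
    (f := fun p : PuncturedSquare => p.1.2) (by fun_prop) (isCompact_g₂_diff_preimage hW hk) (by
      rintro ⟨⟨a, b⟩, hp⟩ ⟨h1, -⟩ (rfl : b = ⊤)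
      exact h1 (by simp [g₁]))
  filter_upwards [h] with n hn
  by_contra hnW
  refine hn ⟨⟨((n + 1 : ℕ), n), by simp⟩, ⟨?_, hnW⟩, rfl⟩
  simp only [g₂, g₁, mem_compl_iff, mem_ofPred_eq, not_le, Nat.cast_lt]
  omega

/-- The points with finite coordinates are dense. -/
theorem exists_fin_mem {W : Set FrameSpace} (hW : IsOpen W) {x : FrameSpace} (hx : x ∈ W) :
    ∃ i j, fin i j ∈ W := by
  revert hx
  refine cases_point (P := fun x => x ∈ W → ∃ i j, fin i j ∈ W) ?_ ?_ ?_ ?_ ?_ x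
  · exact fun i j h => ⟨i, j, h⟩
  · intro i h
    obtain ⟨n, hn⟩ := ((tendsto_fin_top i).eventually (hW.mem_nhds h)).exists
    exact ⟨_, _, hn⟩
  · intro j h
    obtain ⟨n, hn⟩ := ((tendsto_fin_right j).eventually (hW.mem_nhds h)).exists
    exact ⟨_, _, hn⟩
  · intro h
    obtain ⟨n, hn⟩ := (tendsto_fin_k₁.eventually (hW.mem_nhds h)).exists
    exact ⟨_, _, hn⟩
  · intro h
    obtain ⟨n, hn⟩ := (tendsto_fin_k₂.eventually (hW.mem_nhds h)).exists
    exact ⟨_, _, hn⟩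

theorem denseRange_pt : DenseRange pt := by
  refine dense_iff_inter_open.2 fun W hW ⟨x, hx⟩ => ?_
  obtain ⟨i, j, h⟩ := exists_fin_mem hW hx
  exact ⟨_, h, _, rfl⟩

/-! ### Openness of the coordinate maps and the descriptive frame -/

theorem isOpenMap_row : IsOpenMap row := by
  intro W hW
  -- Finite values are isolated, so only points of row `ω` matter; each is a limit of points whose
  -- `n`-th term lies in row `n`.
  refine ENat.isOpen_of_eventually ?_
  rintro ⟨x, hx, hr⟩
  revert hx hr
  refine cases_point (P := fun x => x ∈ W → row x = ⊤ → ∀ᶠ n : ℕ in atTop, (n : ℕ∞) ∈ row '' W)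
    ?_ ?_ ?_ ?_ ?_ x
  · exact fun i j _ h => (ENat.natCast_ne_top j h).elim
  · intro i h _
    filter_upwards [(tendsto_fin_top i).eventually (hW.mem_nhds h)] with n hn using ⟨_, hn, rfl⟩
  · exact fun j _ h => (ENat.natCast_ne_top j h).elim
  · intro h _
    filter_upwards [tendsto_fin_k₁.eventually (hW.mem_nhds h)] with n hn using ⟨_, hn, rfl⟩
  · intro h _
    filter_upwards [tendsto_fin_k₂.eventually (hW.mem_nhds h)] with n hn using ⟨_, hn, rfl⟩

theorem isOpenMap_column : IsOpenMap column := by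
  intro W hW
  refine ENat.isOpen_of_eventually ?_
  rintro ⟨x, hx, hr⟩
  revert hx hr
  refine cases_point
    (P := fun x => x ∈ W → column x = ⊤ → ∀ᶠ n : ℕ in atTop, (n : ℕ∞) ∈ column '' W)
    ?_ ?_ ?_ ?_ ?_ x
  · exact fun i j _ h => (ENat.natCast_ne_top i h).elim
  · exact fun i _ h => (ENat.natCast_ne_top i h).elim
  · intro j h _
    filter_upwards [(tendsto_fin_right j).eventually (hW.mem_nhds h)] with n hn using ⟨_, hn, rfl⟩
  · intro h _
    filter_upwards [tendsto_fin_k₁.eventually (hW.mem_nhds h)] with n hn using ⟨_, hn, rfl⟩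
  · intro h _
    refine eventually_atTop.2 ?_
    obtain ⟨N, hN⟩ := eventually_atTop.1 (tendsto_fin_k₂.eventually (hW.mem_nhds h))
    -- The `m`-th term of the sequence tending to `k₂` lies in column `m + 1`, hence the shift.
    refine ⟨N + 1, fun n hn => ?_⟩
    obtain ⟨m, rfl⟩ : ∃ m, n = m + 1 := ⟨n - 1, by omega⟩
    exact ⟨_, hN m (by omega), rfl⟩

/-- The kernel of an open continuous map from a compact space to a Hausdorff space is a continuous
relation. -/
theorem isContinuousRel_ker {Y Z : Type*} [TopologicalSpace Y] [CompactSpace Y]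
    [TopologicalSpace Z] [T2Space Z] {f : Y → Z} (hf : Continuous f) (ho : IsOpenMap f) :
    IsContinuousRel fun x y => f x = f y := by
  refine ⟨fun x => isClosed_eq continuous_const hf, fun U hU => ?_⟩
  have : {y | ∃ x ∈ U, f y = f x} = f ⁻¹' (f '' U) := by
    ext y
    simp [eq_comm]
  rw [this]
  exact IsClopen.preimage ⟨(hU.isClosed.isCompact.image hf).isClosed, ho U hU.isOpen⟩ hf

theorem isClopen_setOf_le_column (n : ℕ) : IsClopen {x | (n : ℕ∞) ≤ column x} :=
  (ENat.isClopen_Ici_natCast n).preimage continuous_column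

theorem isClopen_setOf_le_row (n : ℕ) : IsClopen {x | (n : ℕ∞) ≤ row x} :=
  (ENat.isClopen_Ici_natCast n).preimage continuous_row

theorem exists_natCast_separating {a b : ℕ∞} (h : a ≠ b) :
    ∃ n : ℕ, ¬ ((n : ℕ∞) ≤ a ↔ (n : ℕ∞) ≤ b) := by
  by_contra! hn
  exact h (ENat.eq_of_forall_natCast_le_iff hn)

/-- The clopen sets `g`, `{x | n ≤ column x}` and `{x | n ≤ row x}` separate points. -/
theorem exists_separating {S : Set (Set FrameSpace)} (hS : ∀ U ∈ S, Uᶜ ∈ S) (hg : g ∈ S)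
    (hc : ∀ n : ℕ, {x | (n : ℕ∞) ≤ column x} ∈ S) (hr : ∀ n : ℕ, {x | (n : ℕ∞) ≤ row x} ∈ S)
    {x y : FrameSpace} (hxy : x ≠ y) : ∃ U ∈ S, x ∈ U ∧ y ∉ U := by
  have key : ∀ U ∈ S, ¬ (x ∈ U ↔ y ∈ U) → ∃ U ∈ S, x ∈ U ∧ y ∉ U := by
    intro U hU h
    by_cases hx : x ∈ U
    · exact ⟨U, hU, hx, by tauto⟩
    · exact ⟨Uᶜ, hS U hU, hx, by rw [mem_compl_iff]; tauto⟩
  by_cases h1 : column x = column y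
  · by_cases h2 : row x = row y
    · exact key _ hg fun h => hxy (ext_column_row h1 h2 h)
    · obtain ⟨n, hn⟩ := exists_natCast_separating h2
      exact key _ (hr n) hn
  · obtain ⟨n, hn⟩ := exists_natCast_separating h1
    exact key _ (hc n) hn

instance : TotallySeparatedSpace FrameSpace := by
  rw [totallySeparatedSpace_iff_exists_isClopen]
  intro x y hxy
  exact exists_separating (S := {U | IsClopen U}) (fun U hU => IsClopen.compl hU) isClopen_g
    isClopen_setOf_le_column isClopen_setOf_le_row hxy

theorem isStoneSpace : IsStoneSpace FrameSpace where
  compact := inferInstance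
  hausdorff := inferInstance
  zeroDim := isTopologicalBasis_isClopen

/-- Every row meets every column. -/
theorem exists_column_row (a b : ℕ∞) : ∃ x, column x = a ∧ row x = b := by
  by_cases h : (a, b) = (⊤, ⊤)
  · simp only [Prod.mk.injEq] at h
    exact ⟨k₁, h.1.symm, h.2.symm⟩
  · exact ⟨pt ⟨(a, b), h⟩, rfl, rfl⟩

theorem isDescriptiveS5SqFrame : IsDescriptiveS5SqFrame FrameSpace E₁ E₂ where
  stone := isStoneSpace
  refl _ := rfl
  trans _ _ _ h h' := Eq.trans h h'
  equiv := ⟨fun _ => rfl, fun h => Eq.symm h, fun h h' => Eq.trans h h'⟩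
  cont_R := isContinuousRel_ker continuous_row isOpenMap_row
  cont_E := isContinuousRel_ker continuous_column isOpenMap_column
  comm x y y' _ _ := by
    obtain ⟨z, hz, hz'⟩ := exists_column_row (column y') (row x)
    exact ⟨z, hz'.symm, hz⟩
  symm _ _ h := Eq.symm h

end FrameSpace

/-! ### Separating algebras and generated subalgebras -/

/-- In a compact space, an algebra of clopen sets that separates points contains all of them. -/
theorem BooleanSubalgebra.eq_top_of_separating {Y : Type*} [TopologicalSpace Y] [CompactSpace Y]
    (L : BooleanSubalgebra (TopologicalSpace.Clopens Y))
    (h : ∀ x y : Y, x ≠ y → ∃ U ∈ L, x ∈ U ∧ y ∉ U) : L = ⊤ := by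
  refine eq_top_iff.2 fun V _ => ?_
  -- Compactness is used twice: finite meets separate one point of `V` from all of `Vᶜ`, then finite
  -- joins of such sets exhaust `V`.
  have h1 : ∀ x ∈ V, ∃ U ∈ L, x ∈ U ∧ Disjoint (U : Set Y) (V : Set Y)ᶜ := by
    intro x hx
    refine V.isClopen.compl.isClosed.isCompact.induction_on
      (p := fun K => ∃ U ∈ L, x ∈ U ∧ Disjoint (U : Set Y) K) ?_ ?_ ?_ ?_
    · exact ⟨⊤, BooleanSubalgebra.top_mem, trivial, disjoint_bot_right⟩
    · rintro s t hst ⟨U, hU, hxU, hd⟩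
      exact ⟨U, hU, hxU, hd.mono_right hst⟩
    · rintro s t ⟨U, hU, hxU, hd⟩ ⟨U', hU', hxU', hd'⟩
      refine ⟨U ⊓ U', BooleanSubalgebra.inf_mem hU hU', ⟨hxU, hxU'⟩, ?_⟩
      exact disjoint_union_right.2
        ⟨hd.mono_left inter_subset_left, hd'.mono_left inter_subset_right⟩
    · intro y hy
      obtain ⟨U, hU, hxU, hyU⟩ := h x y fun hxy => hy (hxy ▸ hx)
      exact ⟨(U : Set Y)ᶜ, mem_nhdsWithin_of_mem_nhds (U.isClopen.compl.isOpen.mem_nhds hyU),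
        U, hU, hxU, disjoint_compl_right⟩
  have h2 : ∃ U ∈ L, (V : Set Y) ⊆ U ∧ U ≤ V := by
    refine V.isClopen.isClosed.isCompact.induction_on
      (p := fun K => ∃ U ∈ L, K ⊆ (U : Set Y) ∧ U ≤ V) ?_ ?_ ?_ ?_
    · exact ⟨⊥, BooleanSubalgebra.bot_mem, empty_subset _, bot_le⟩
    · rintro s t hst ⟨U, hU, htU, hle⟩
      exact ⟨U, hU, hst.trans htU, hle⟩
    · rintro s t ⟨U, hU, hsU, hle⟩ ⟨U', hU', htU', hle'⟩
      exact ⟨U ⊔ U', BooleanSubalgebra.sup_mem hU hU', union_subset_union hsU htU',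
        sup_le hle hle'⟩
    · intro x hx
      obtain ⟨U, hU, hxU, hd⟩ := h1 x hx
      exact ⟨U, mem_nhdsWithin_of_mem_nhds (U.isClopen.isOpen.mem_nhds hxU), U, hU, subset_rfl,
        disjoint_compl_right_iff_subset.1 hd⟩
  obtain ⟨U, hU, hVU, hUV⟩ := h2
  rwa [le_antisymm hUV hVU] at hU

namespace MS4Algebra

theorem subset_generated {B : Type*} [BooleanAlgebra B] (A : MS4Algebra B) (s : Set B) :
    s ⊆ A.generated s := fun _ ha => BooleanSubalgebra.mem_sInf.2 fun _ hL => hL.1 ha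

theorem generated_le {B : Type*} [BooleanAlgebra B] {A : MS4Algebra B} {s : Set B}
    {L : BooleanSubalgebra B} (h : s ⊆ L) (hL : A.IsSubalgebra L) : A.generated s ≤ L :=
  sInf_le ⟨h, hL⟩

/-- Homomorphic images commute with generation of subalgebras. -/
theorem map_generated {B C : Type*} [BooleanAlgebra B] [BooleanAlgebra C] {A : MS4Algebra B}
    {A' : MS4Algebra C} (f : BoundedLatticeHom B C) (hd : ∀ a, f (A.dia a) = A'.dia (f a))
    (he : ∀ a, f (A.ex a) = A'.ex (f a)) (s : Set B) :
    (A.generated s).map f = A'.generated (f '' s) := by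
  apply le_antisymm
  · rw [BooleanSubalgebra.map_le_iff_le_comap]
    have hs := A'.generated_isSubalgebra (f '' s)
    refine generated_le (fun a ha => A'.subset_generated _ ⟨a, ha, rfl⟩)
      ⟨fun a ha => ?_, fun a ha => ?_⟩
    · rw [BooleanSubalgebra.mem_comap, hd]
      exact hs.1 _ ha
    · rw [BooleanSubalgebra.mem_comap, he]
      exact hs.2 _ ha
  · have hs := A.generated_isSubalgebra s
    refine generated_le (image_mono (A.subset_generated s)) ⟨?_, ?_⟩
    · rintro _ ⟨a, ha, rfl⟩
      exact ⟨A.dia a, hs.1 a ha, hd a⟩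
    · rintro _ ⟨a, ha, rfl⟩
      exact ⟨A.ex a, hs.2 a ha, he a⟩

/-- An algebra generated by `s` that embeds into `A'` is isomorphic to the subalgebra of `A'`
generated by the image of `s`. -/
theorem IsGeneratedBy.isIsomorphic {B C : Type*} [BooleanAlgebra B] [BooleanAlgebra C]
    {A : MS4Algebra B} {A' : MS4Algebra C} {s : Set B} (hs : A.IsGeneratedBy s)
    (f : BoundedLatticeHom B C) (hf : ∀ a b, f a ≤ f b → a ≤ b)
    (hd : ∀ a, f (A.dia a) = A'.dia (f a)) (he : ∀ a, f (A.ex a) = A'.ex (f a)) :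
    A.IsIsomorphic
      (A'.restrict (A'.generated (f '' s)) (A'.generated_isSubalgebra (f '' s))) := by
  have hmap := map_generated f hd he s
  rw [hs] at hmap
  have hmem : ∀ a, f a ∈ A'.generated (f '' s) := fun a => by
    rw [← hmap]
    exact ⟨a, trivial, rfl⟩
  let e : B ↪o A'.generated (f '' s) :=
    OrderEmbedding.ofMapLEIff (fun a => ⟨f a, hmem a⟩)
      fun a b => ⟨hf a b, fun hab => OrderHomClass.mono f hab⟩
  have hsurj : Function.Surjective e := by
    rintro ⟨b, hb⟩
    rw [← hmap] at hb
    obtain ⟨a, -, rfl⟩ := hb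
    exact ⟨a, rfl⟩
  exact ⟨RelIso.ofSurjective e hsurj, fun a => Subtype.ext (hd a), fun a => Subtype.ext (he a)⟩

end MS4Algebra

theorem IsDescriptiveS5SqFrame.isS5Sq {Y : Type*} [TopologicalSpace Y] {R E : Y → Y → Prop}
    (h : IsDescriptiveS5SqFrame Y R E) : (dualAlgebra h.toIsDescriptiveMS4Frame).IsS5Sq := by
  rintro U y ⟨x, hx, hyx⟩ ⟨z, hz, hyz⟩
  exact hx ⟨z, hz, h.trans _ _ _ (h.symm _ _ hyx) hyz⟩

/-! ### Generation of the dual algebra by `g` -/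

namespace FrameSpace

/-- The dual algebra of the frame. -/
def dual : MS4Algebra (TopologicalSpace.Clopens FrameSpace) :=
  dualAlgebra isDescriptiveS5SqFrame.toIsDescriptiveMS4Frame

theorem mem_dual_dia {U : TopologicalSpace.Clopens FrameSpace} {x : FrameSpace} :
    x ∈ dual.dia U ↔ ∃ y ∈ U, row x = row y := .rfl

theorem mem_dual_ex {U : TopologicalSpace.Clopens FrameSpace} {x : FrameSpace} :
    x ∈ dual.ex U ↔ ∃ y ∈ U, column y = column x := .rfl

/-- The element `g` of the dual algebra. -/
def gClopen : TopologicalSpace.Clopens FrameSpace := ⟨g, isClopen_g⟩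

/-- The set of points in the columns from `n` on, as an element of the dual algebra. -/
def columnGE (n : ℕ) : TopologicalSpace.Clopens FrameSpace :=
  ⟨{x | (n : ℕ∞) ≤ column x}, isClopen_setOf_le_column n⟩

/-- The set of points in the rows from `n` on, as an element of the dual algebra. -/
def rowGE (n : ℕ) : TopologicalSpace.Clopens FrameSpace :=
  ⟨{x | (n : ℕ∞) ≤ row x}, isClopen_setOf_le_row n⟩

theorem column_le_row_of_mem_g {x : FrameSpace} (hx : x ∈ g) : column x ≤ row x := by
  rcases x with p | _ | _
  · have h : p ∈ g₁ := by simpa [g] using hx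
    exact h
  · exact le_rfl
  · exact le_rfl

/-- Strictness fails at `k₂`, which lies outside `g` with both coordinates `ω`; `hr` excludes it. -/
theorem row_lt_column_of_notMem_g {x : FrameSpace} (hx : x ∉ g) (hr : row x ≠ ⊤) :
    row x < column x := by
  rcases x with p | _ | _
  · exact not_le.1 fun h => hx (Or.inl ⟨p, h, rfl⟩)
  · exact (hr rfl).elim
  · exact (hr rfl).elim

/-- Row `m` meets `g` in the diagonal point of column `m`, with `k₁` in that role for row `ω`;
conversely, points of `g` never lie below the diagonal. -/
theorem rowGE_eq (n : ℕ) : rowGE n = dual.dia (gClopen ⊓ columnGE n) := by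
  ext x
  constructor
  · intro (hx : (n : ℕ∞) ≤ row x)
    by_cases h : row x = ⊤
    · exact ⟨k₁, ⟨k₁_mem_g, le_top (a := (n : ℕ∞))⟩, h⟩
    · obtain ⟨m, hm⟩ := ENat.ne_top_iff_exists.1 h
      rw [← hm] at hx
      exact ⟨fin m m, ⟨fin_mem_g.2 le_rfl, hx⟩, hm.symm⟩
  · rintro ⟨y, ⟨hy, hy'⟩, hxy⟩
    exact (le_trans hy' (column_le_row_of_mem_g hy)).trans_eq hxy.symm

/-- Outside `g` the column strictly exceeds a finite row, which is what raises the index by one. For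
column `m > n` the witness is `(m, n)`, for column `ω` it is `k₂`. -/
theorem columnGE_succ_eq (n : ℕ) : columnGE (n + 1) = dual.ex (gClopenᶜ ⊓ rowGE n) := by
  ext x
  constructor
  · intro (hx : ((n + 1 : ℕ) : ℕ∞) ≤ column x)
    by_cases h : column x = ⊤
    · exact ⟨k₂, ⟨k₂_notMem_g, le_top (a := (n : ℕ∞))⟩, h.symm⟩
    · obtain ⟨m, hm⟩ := ENat.ne_top_iff_exists.1 h
      rw [← hm] at hx
      have hx' : n + 1 ≤ m := by exact_mod_cast hx
      exact ⟨fin m n, ⟨fun hg => absurd (fin_mem_g.1 hg) (by omega), le_refl (n : ℕ∞)⟩, hm⟩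
  · rintro ⟨y, ⟨hy, (hy' : (n : ℕ∞) ≤ row y)⟩, (hxy : column y = column x)⟩
    change ((n + 1 : ℕ) : ℕ∞) ≤ column x
    rw [← hxy, Nat.cast_add, Nat.cast_one, ENat.add_one_le_iff (ENat.natCast_ne_top n)]
    by_cases h : row y = ⊤
    · have : column y = ⊤ := by
        rcases y with p | _ | _
        · exact (hy (Or.inl ⟨p, le_top.trans_eq h.symm, rfl⟩)).elim
        · rfl
        · rfl
      rw [this]
      exact ENat.natCast_lt_top n
    · exact hy'.trans_lt (row_lt_column_of_notMem_g hy h)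

theorem isGeneratedBy_g : dual.IsGeneratedBy {gClopen} := by
  set L := dual.generated {gClopen}
  obtain ⟨hdia, hex⟩ : dual.IsSubalgebra L := dual.generated_isSubalgebra _
  have hg : gClopen ∈ L := dual.subset_generated _ rfl
  have hrow : ∀ n, columnGE n ∈ L → rowGE n ∈ L := fun n hn => by
    rw [rowGE_eq]
    exact hdia _ (BooleanSubalgebra.inf_mem hg hn)
  have hcol : ∀ n, columnGE n ∈ L := by
    intro n
    induction n with
    | zero =>
      have : columnGE 0 = ⊤ := by
        ext x
        simp [columnGE]
      rw [this]
      exact BooleanSubalgebra.top_mem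
    | succ n ih =>
      rw [columnGE_succ_eq]
      exact hex _ (BooleanSubalgebra.inf_mem (BooleanSubalgebra.compl_mem hg) (hrow n ih))
  refine BooleanSubalgebra.eq_top_of_separating _ fun x y hxy => ?_
  obtain ⟨_, ⟨U, hU, rfl⟩, hx, hy⟩ := exists_separating
    (S := (fun U : TopologicalSpace.Clopens FrameSpace => (U : Set FrameSpace)) '' L)
    (by
      rintro _ ⟨U, hU, rfl⟩
      exact ⟨Uᶜ, BooleanSubalgebra.compl_mem hU, rfl⟩)
    ⟨gClopen, hg, rfl⟩ (fun n => ⟨columnGE n, hcol n, rfl⟩)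
    (fun n => ⟨rowGE n, hrow n (hcol n), rfl⟩) hxy
  exact ⟨U, hU, hx, hy⟩

/-! ### Embedding into the powerset of `ω × ω` -/

/-- The trace of a clopen set on `ω × ω`. -/
def trace : BoundedLatticeHom (TopologicalSpace.Clopens FrameSpace) (Set (ℕ × ℕ)) where
  toFun U := {p | fin p.1 p.2 ∈ U}
  map_sup' _ _ := rfl
  map_inf' _ _ := rfl
  map_top' := rfl
  map_bot' := rfl

theorem mem_trace {U : TopologicalSpace.Clopens FrameSpace} {p : ℕ × ℕ} :
    p ∈ trace U ↔ fin p.1 p.2 ∈ U := .rfl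

/-- If the open set `U ∩ Vᶜ` is nonempty, density gives it a point with finite coordinates. -/
theorem le_of_trace_le {U V : TopologicalSpace.Clopens FrameSpace} (h : trace U ≤ trace V) :
    U ≤ V := by
  intro x hx
  by_contra hxV
  obtain ⟨i, j, hU, hV⟩ := exists_fin_mem (U.isClopen.isOpen.inter V.isClopen.compl.isOpen)
    (show x ∈ (U : Set FrameSpace) ∩ (V : Set FrameSpace)ᶜ from ⟨hx, hxV⟩)
  exact hV (h (show (i, j) ∈ trace U from hU))

theorem trace_dia (U : TopologicalSpace.Clopens FrameSpace) :
    trace (dual.dia U) = squareAlgebra.dia (trace U) := by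
  ext ⟨i, j⟩
  rw [mem_trace, mem_dual_dia]
  constructor
  · rintro ⟨x, hx, hr⟩
    -- The witness `x` may have column `ω`; since row `j` is open, density replaces `x` by a finite
    -- point of `U` in the same row.
    obtain ⟨a, b, hU, hb⟩ := exists_fin_mem (U.isClopen.isOpen.inter
      ((ENat.isClopen_singleton_natCast j).preimage continuous_row).isOpen)
      (show x ∈ (U : Set FrameSpace) ∩ row ⁻¹' {(j : ℕ∞)} from ⟨hx, hr.symm⟩)
    exact ⟨(a, b), hU, by simpa using hb⟩
  · rintro ⟨⟨a, b⟩, hU, rfl⟩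
    exact ⟨fin a b, hU, rfl⟩

theorem trace_ex (U : TopologicalSpace.Clopens FrameSpace) :
    trace (dual.ex U) = squareAlgebra.ex (trace U) := by
  ext ⟨i, j⟩
  rw [mem_trace, mem_dual_ex]
  constructor
  · rintro ⟨x, hx, hr⟩
    obtain ⟨a, b, hU, hb⟩ := exists_fin_mem (U.isClopen.isOpen.inter
      ((ENat.isClopen_singleton_natCast i).preimage continuous_column).isOpen)
      (show x ∈ (U : Set FrameSpace) ∩ column ⁻¹' {(i : ℕ∞)} from ⟨hx, hr⟩)
    exact ⟨(a, b), hU, by simpa using hb⟩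
  · rintro ⟨⟨a, b⟩, hU, rfl⟩
    exact ⟨fin a b, hU, rfl⟩

theorem isIsomorphic_erdosTarskiAlgebra : dual.IsIsomorphic erdosTarskiAlgebra := by
  have h := isGeneratedBy_g.isIsomorphic trace (fun _ _ => le_of_trace_le) trace_dia trace_ex
  have hg : trace '' {gClopen} = {upperTriangle} := by
    rw [image_singleton]
    congr 1
    ext ⟨i, j⟩
    exact fin_mem_g
  -- The algebra's carrier type depends on its generating set, so the equality `hg` is substituted
  -- with that set as a variable.
  have key : ∀ s : Set (Set (ℕ × ℕ)), s = {upperTriangle} →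
      dual.IsIsomorphic (squareAlgebra.restrict _ (squareAlgebra.generated_isSubalgebra s)) →
      dual.IsIsomorphic erdosTarskiAlgebra := by
    rintro _ rfl h
    exact h
  exact key _ hg h

/-! ### Infinitely many limit points of depth 1 -/

theorem top_injective : Function.Injective top := fun i j h => by
  simpa using congrArg column h

theorem accPt_top (i : ℕ) : AccPt (top i) (𝓟 univ) := by
  refine accPt_iff_nhds.2 fun U hU => ?_
  obtain ⟨n, hn⟩ := ((tendsto_fin_top i).eventually hU).exists
  exact ⟨fin i n, ⟨hn, trivial⟩, fun h => ENat.natCast_ne_top n (congrArg row h)⟩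

theorem quasiMax_E₁ : quasiMax E₁ univ = univ :=
  eq_univ_of_forall fun _ => ⟨trivial, fun _ _ h => Eq.symm h⟩

end FrameSpace

theorem mainTheorem6 :
    -- `X` is a two-point compactification of `X₀`
    TopologicalSpace.IsTopologicalBasis FrameSpace.basis ∧
    Topology.IsOpenEmbedding FrameSpace.pt ∧
    DenseRange FrameSpace.pt ∧
    -- the frame is a descriptive S5²-frame, with the following dual algebra
    ∃ hF : IsDescriptiveS5SqFrame FrameSpace FrameSpace.E₁ FrameSpace.E₂,
      (dualAlgebra hF.toIsDescriptiveMS4Frame).IsS5Sq ∧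
      (∃ hg : IsClopen FrameSpace.g,
        (dualAlgebra hF.toIsDescriptiveMS4Frame).IsGeneratedBy {⟨FrameSpace.g, hg⟩}) ∧
      (dualAlgebra hF.toIsDescriptiveMS4Frame).IsOneGenerated ∧
      (dualAlgebra hF.toIsDescriptiveMS4Frame).IsIsomorphic erdosTarskiAlgebra ∧
      -- a finitely generated frame with infinitely many points, all of depth 1, and with
      -- infinitely many limit points
      (dualAlgebra hF.toIsDescriptiveMS4Frame).IsFinitelyGenerated ∧
      quasiMax FrameSpace.E₁ Set.univ = Set.univ ∧
      (quasiMax FrameSpace.E₁ Set.univ).Infinite ∧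
      {x ∈ quasiMax FrameSpace.E₁ Set.univ | AccPt x (Filter.principal Set.univ)}.Infinite := by
  refine ⟨FrameSpace.isTopologicalBasis_basis, FrameSpace.isOpenEmbedding_pt,
    FrameSpace.denseRange_pt, FrameSpace.isDescriptiveS5SqFrame,
    FrameSpace.isDescriptiveS5SqFrame.isS5Sq,
    ⟨FrameSpace.isClopen_g, FrameSpace.isGeneratedBy_g⟩, ⟨_, FrameSpace.isGeneratedBy_g⟩,
    FrameSpace.isIsomorphic_erdosTarskiAlgebra,
    ⟨_, Set.finite_singleton _, FrameSpace.isGeneratedBy_g⟩, FrameSpace.quasiMax_E₁, ?_, ?_⟩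
  · rw [FrameSpace.quasiMax_E₁]
    exact (Set.infinite_range_of_injective FrameSpace.top_injective).mono (Set.subset_univ _)
  · refine (Set.infinite_range_of_injective FrameSpace.top_injective).mono ?_
    rintro _ ⟨i, rfl⟩
    exact ⟨by rw [FrameSpace.quasiMax_E₁]; trivial, FrameSpace.accPt_top i⟩
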